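/- Let $r_0>0$ and $0<L_0\le 1$ be constants, let $I,J\subseteq\mathbb R$ be open, and let $\xi:I\to\mathbb R$, $h:J\to\mathbb R$ be smooth and nowhere zero. On $M=\{(t,r,\theta,\phi): r\in I,\ \theta\in J\}\subseteq\mathbb R^4$ consider the CNS (charged Nariai) type metric $$g:\quad ds^2=\frac{r_0^2}{L_0}\left(-\xi(r)^2dt^2+dr^2\right)+r_0^2\left(d\theta^2+h(\theta)^2d\phi^2\right).$$ Conventions (summation over repeated indices, $n=4$): $R^s_{pqr}\partial_s=\nabla_p\nabla_q\partial_r-\nabla_q\nabla_p\partial_r$, $R_{pqrs}=g_{st}R^t_{pqr}$; the Ricci tensor is $S_{pr}=R^s_{psr}$ (so $S_{11}=-\xi\xi''$, $S_{22}=\xi''/\xi$, $S_{33}=h''/h$, $S_{44}=hh''$), the Ricci operator $S^s_q$ is given by $S_{pq}=g_{ps}S^s_q$, $S^2_{pq}=S_{ps}S^s_q$, $\kappa=S^s_s$; the conformal curvature tensor is $$C^s_{pqr}=R^s_{pqr}+\tfrac1{n-2}\left(\delta^s_pS_{qr}-\delta^s_qS_{pr}+S^s_pg_{qr}-S^s_qg_{pr}\right)-\tfrac{\kappa}{(n-1)(n-2)}\left(\delta^s_pg_{qr}-\delta^s_qg_{pr}\right),\qquad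 C_{pqrs}=g_{st}C^t_{pqr}.$$ For $(0,4)$-tensors $U,T$ and symmetric $(0,2)$-tensors $Z,E,A$ put $$(U\cdot T)_{p_1\dots p_4rs}=-g^{\alpha\beta}\left[U_{rsp_1\beta}T_{\alpha p_2p_3p_4}+\dots+U_{rsp_4\beta}T_{p_1p_2p_3\alpha}\right],$$ $$Q(Z,T)_{p_1\dots p_4rs}=Z_{sp_1}T_{rp_2p_3p_4}+\dots+Z_{sp_4}T_{p_1p_2p_3r}-Z_{rp_1}T_{sp_2p_3p_4}-\dots-Z_{rp_4}T_{p_1p_2p_3s},$$ $$(E\wedge A)_{pqrs}=E_{ps}A_{qr}-E_{pr}A_{qs}+E_{qr}A_{ps}-E_{qs}A_{pr}.$$ Then $g$ is of Roter type on the open set $\{L_0h\xi''-\xi h''\neq0\}$: there are smooth functions $\mu_1,\mu_2,\mu_3$ on this set with $$R=\mu_1\,g\wedge g+\mu_2\,g\wedge S+\mu_3\,S\wedge S .$$ Moreover, on all of $M$: (i) $R\cdot R=0$; (ii) $C\cdot R=J'\,Q(g,R)$ with $J'=-\dfrac{L_0h\xi''+\xi h''}{6r_0^2\,\xi h}$;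 (iii) $S^2-\dfrac{L_0h\xi''+\xi h''}{r_0^2\,\xi h}\,S+\dfrac{L_0\,\xi''h''}{r_0^4\,\xi h}\,g=0$. -/

import Mathlib

open scoped ContDiff

namespace CNSType

noncomputable section

/-- The partial derivative `∂f/∂xⁱ` at `x`, for a function of `n` real coordinates. -/
def pd {n : ℕ} (i : Fin n) (f : (Fin n → ℝ) → ℝ) (x : Fin n → ℝ) : ℝ :=
  deriv (fun s : ℝ => f (Function.update x i s)) (x i)

/-- Christoffel symbols of the second kind, `christoffel g k i j x = Γ^k_{ij}(x)`, of the metric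
with component matrix `g` in the coordinates. -/
def christoffel {n : ℕ} (g : (Fin n → ℝ) → Matrix (Fin n) (Fin n) ℝ)
    (k i j : Fin n) (x : Fin n → ℝ) : ℝ :=
  (1 / 2) * ∑ l, (g x)⁻¹ k l *
    (pd i (fun y => g y j l) x + pd j (fun y => g y i l) x - pd l (fun y => g y i j) x)

/-- The curvature tensor of type (1,3): `riem13 g s p q r x = R^s_{pqr}(x)`, where
`R^s_{pqr} ∂_s = ∇_p ∇_q ∂_r - ∇_q ∇_p ∂_r`. -/
def riem13 {n : ℕ} (g : (Fin n → ℝ) → Matrix (Fin n) (Fin n) ℝ)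
    (s p q r : Fin n) (x : Fin n → ℝ) : ℝ :=
  pd p (christoffel g s q r) x - pd q (christoffel g s p r) x
    + ∑ t, (christoffel g s p t x * christoffel g t q r x
      - christoffel g s q t x * christoffel g t p r x)

/-- The curvature tensor of type (0,4): `R_{pqrs} = g_{st} R^t_{pqr}`. -/
def riem {n : ℕ} (g : (Fin n → ℝ) → Matrix (Fin n) (Fin n) ℝ) (x : Fin n → ℝ)
    (p q r s : Fin n) : ℝ :=
  ∑ t, g x s t * riem13 g t p q r x

/-- The Ricci tensor `S_{pr} = R^s_{psr}`. This is the contraction for which the conformal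
curvature tensor `weyl13` below is trace-free; with it a round sphere has negative Ricci tensor. -/
def ricci {n : ℕ} (g : (Fin n → ℝ) → Matrix (Fin n) (Fin n) ℝ) (x : Fin n → ℝ)
    (p r : Fin n) : ℝ :=
  ∑ s, riem13 g s p s r x

/-- The Ricci operator `S^s_q`, given by `S_{pq} = g_{ps} S^s_q`. -/
def ricciOp {n : ℕ} (g : (Fin n → ℝ) → Matrix (Fin n) (Fin n) ℝ) (x : Fin n → ℝ)
    (s q : Fin n) : ℝ :=
  ∑ p, (g x)⁻¹ s p * ricci g x p q

/-- The Ricci tensor of level two, `S²_{pq} = S_{ps} S^s_q`. -/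
def ricciSq {n : ℕ} (g : (Fin n → ℝ) → Matrix (Fin n) (Fin n) ℝ) (x : Fin n → ℝ)
    (p q : Fin n) : ℝ :=
  ∑ s, ricci g x p s * ricciOp g x s q

/-- The scalar curvature `κ`, the trace of the Ricci operator. -/
def scal {n : ℕ} (g : (Fin n → ℝ) → Matrix (Fin n) (Fin n) ℝ) (x : Fin n → ℝ) : ℝ :=
  ∑ s, ricciOp g x s s

/-- The Kronecker symbol `δ^s_p`. -/
def kron {n : ℕ} (s p : Fin n) : ℝ := if s = p then 1 else 0

/-- The conformal (Weyl) curvature tensor of type (1,3): `weyl13 g x s p q r = C^s_{pqr}(x)`. -/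
def weyl13 {n : ℕ} (g : (Fin n → ℝ) → Matrix (Fin n) (Fin n) ℝ) (x : Fin n → ℝ)
    (s p q r : Fin n) : ℝ :=
  riem13 g s p q r x
    + 1 / ((n : ℝ) - 2) * (kron s p * ricci g x q r - kron s q * ricci g x p r
        + ricciOp g x s p * g x q r - ricciOp g x s q * g x p r)
    - scal g x / (((n : ℝ) - 1) * ((n : ℝ) - 2)) * (kron s p * g x q r - kron s q * g x p r)

/-- The conformal curvature tensor of type (0,4): `C_{pqrs} = g_{st} C^t_{pqr}`. -/
def weyl {n : ℕ} (g : (Fin n → ℝ) → Matrix (Fin n) (Fin n) ℝ) (x : Fin n → ℝ)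
    (p q r s : Fin n) : ℝ :=
  ∑ t, g x s t * weyl13 g x t p q r

/-- The (0,6)-tensor `U · T` at a point with inverse metric `ginv`, for (0,4)-tensors `U`, `T`:
`(U·T)_{p₁p₂p₃p₄rs} = -g^{αβ} [U_{rsp₁β} T_{αp₂p₃p₄} + ⋯ + U_{rsp₄β} T_{p₁p₂p₃α}]`. -/
def dotAct {n : ℕ} (ginv : Matrix (Fin n) (Fin n) ℝ) (U T : Fin n → Fin n → Fin n → Fin n → ℝ)
    (p₁ p₂ p₃ p₄ r s : Fin n) : ℝ :=
  -∑ a, ∑ b, ginv a b *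
    (U r s p₁ b * T a p₂ p₃ p₄ + U r s p₂ b * T p₁ a p₃ p₄
      + U r s p₃ b * T p₁ p₂ a p₄ + U r s p₄ b * T p₁ p₂ p₃ a)

/-- The Tachibana tensor `Q(Z,T)`, for a (0,2)-tensor `Z` and a (0,4)-tensor `T`. -/
def tachibana {n : ℕ} (Z : Fin n → Fin n → ℝ) (T : Fin n → Fin n → Fin n → Fin n → ℝ)
    (p₁ p₂ p₃ p₄ r s : Fin n) : ℝ :=
  Z s p₁ * T r p₂ p₃ p₄ + Z s p₂ * T p₁ r p₃ p₄ + Z s p₃ * T p₁ p₂ r p₄ + Z s p₄ * T p₁ p₂ p₃ r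
    - Z r p₁ * T s p₂ p₃ p₄ - Z r p₂ * T p₁ s p₃ p₄ - Z r p₃ * T p₁ p₂ s p₄
    - Z r p₄ * T p₁ p₂ p₃ s

/-- The Kulkarni-Nomizu product of two (0,2)-tensors. -/
def kulkarniNomizu {n : ℕ} (E A : Fin n → Fin n → ℝ) (p q r s : Fin n) : ℝ :=
  E p s * A q r - E p r * A q s + E q r * A p s - E q s * A p r

/-- The metric `g` is of Roter type on `U`: its curvature tensor is a combination of `g ∧ g`,
`g ∧ S` and `S ∧ S`, with smooth scalar functions on `U` as coefficients. -/
def IsRoterTypeOn {n : ℕ} (g : (Fin n → ℝ) → Matrix (Fin n) (Fin n) ℝ)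
    (U : Set (Fin n → ℝ)) : Prop :=
  ∃ μ₁ μ₂ μ₃ : (Fin n → ℝ) → ℝ,
    ContDiffOn ℝ ∞ μ₁ U ∧ ContDiffOn ℝ ∞ μ₂ U ∧ ContDiffOn ℝ ∞ μ₃ U ∧
    ∀ x ∈ U, ∀ p q r s : Fin n,
      riem g x p q r s =
        μ₁ x * kulkarniNomizu (g x) (g x) p q r s
          + μ₂ x * kulkarniNomizu (g x) (ricci g x) p q r s
          + μ₃ x * kulkarniNomizu (ricci g x) (ricci g x) p q r s

/-- The CNS type metric
`ds² = (r₀²/L₀)(-ξ(r)² dt² + dr²) + r₀²(dθ² + h(θ)² dφ²)`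
in the coordinates `x = (t, r, θ, φ)`, so `x 1 = r` and `x 2 = θ`. -/
def cnsMetric (r₀ L₀ : ℝ) (ξ h : ℝ → ℝ) (x : Fin 4 → ℝ) : Matrix (Fin 4) (Fin 4) ℝ :=
  Matrix.diagonal
    ![-(r₀ ^ 2 / L₀ * ξ (x 1) ^ 2), r₀ ^ 2 / L₀, r₀ ^ 2, r₀ ^ 2 * h (x 2) ^ 2]

end

end CNSType

/-! The metric is a product of two surfaces, g = E + F, with E on (t, r) and F on (θ, φ). Each
surface has one curvature function; with a = `cnsEigen₁`, b = `cnsEigen₂` one gets R = -(a/2) E∧E -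
(b/2) F∧F and S = aE + bF. The rest is algebra in E and F.

A tensor U that combines E∧E, F∧F and c E∧F acts like constant curvature on each type of plane, so
(U·T)_{..rs} is a multiple of Q(g,T)_{..rs} (`dotAct_of_sectional`). For T = R this vanishes when r,
s lie in the same factor (`tachibana_product_eq_zero`), so only mixed planes count and U·R = -c
Q(g,R). Here c = 0 for R and c = (a+b)/6 for C (`HasCNSCurvature.weyl_eq`). The Ricci operator has
eigenvalues a and b, hence the quadratic identity; where a ≠ b, E and F are combinations of g and S,
which gives the Roter form. -/

namespace CNSType

noncomputable section

/-! ### Closed forms and the curvature in coordinates -/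

/-- The values of the Christoffel symbols of the CNS type metric at a point where `ξ`, `h` and
their first derivatives are `u`, `u'`, `v`, `v'`. -/
def cnsChristoffel (u u' v v' : ℝ) (k i j : Fin 4) : ℝ :=
  if k = 0 ∧ i = 0 ∧ j = 1 ∨ k = 0 ∧ i = 1 ∧ j = 0 then u' / u
  else if k = 1 ∧ i = 0 ∧ j = 0 then u * u'
  else if k = 2 ∧ i = 3 ∧ j = 3 then -(v * v')
  else if k = 3 ∧ i = 2 ∧ j = 3 ∨ k = 3 ∧ i = 3 ∧ j = 2 then v' / v
  else 0

/-- The part of the CNS type metric on the `(t, r)`-surface. -/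
def cnsBlock₁ (r₀ L₀ : ℝ) (ξ : ℝ → ℝ) (x : Fin 4 → ℝ) : Matrix (Fin 4) (Fin 4) ℝ :=
  Matrix.diagonal ![-(r₀ ^ 2 / L₀ * ξ (x 1) ^ 2), r₀ ^ 2 / L₀, 0, 0]

/-- The part of the CNS type metric on the `(θ, φ)`-surface. -/
def cnsBlock₂ (r₀ : ℝ) (h : ℝ → ℝ) (x : Fin 4 → ℝ) : Matrix (Fin 4) (Fin 4) ℝ :=
  Matrix.diagonal ![0, 0, r₀ ^ 2, r₀ ^ 2 * h (x 2) ^ 2]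

/-- The eigenvalue of the Ricci operator on the `(t, r)`-surface. -/
def cnsEigen₁ (r₀ L₀ : ℝ) (ξ : ℝ → ℝ) (x : Fin 4 → ℝ) : ℝ :=
  L₀ * deriv (deriv ξ) (x 1) / (r₀ ^ 2 * ξ (x 1))

/-- The eigenvalue of the Ricci operator on the `(θ, φ)`-surface. -/
def cnsEigen₂ (r₀ : ℝ) (h : ℝ → ℝ) (x : Fin 4 → ℝ) : ℝ :=
  deriv (deriv h) (x 2) / (r₀ ^ 2 * h (x 2))

theorem pd_const {n : ℕ} (i : Fin n) (c : ℝ) (x : Fin n → ℝ) : pd i (fun _ => c) x = 0 := by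
  simp [pd]

/-- The partial derivative of a function of one of the coordinates. -/
theorem pd_comp_apply {n : ℕ} (i j : Fin n) (f : ℝ → ℝ) (x : Fin n → ℝ) :
    pd i (fun y => f (y j)) x = if i = j then deriv f (x j) else 0 := by
  unfold pd
  split_ifs with hij
  · subst hij
    simp
  · simp [Function.update_of_ne (Ne.symm hij)]

/-- Partial derivatives at `x` depend only on the values near `x`. -/
theorem pd_congr {n : ℕ} {i : Fin n} {f f' : (Fin n → ℝ) → ℝ} {x : Fin n → ℝ}
    (hf : f =ᶠ[nhds x] f') : pd i f x = pd i f' x := by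
  unfold pd
  apply Filter.EventuallyEq.deriv_eq
  have hc : Filter.Tendsto (fun s : ℝ => Function.update x i s) (nhds (x i)) (nhds x) := by
    have : Continuous fun s : ℝ => Function.update x i s := by fun_prop
    simpa using this.tendsto (x i)
  exact hc.eventually hf

theorem inv_diagonal_of_ne_zero {n : ℕ} {d : Fin n → ℝ} (hd : ∀ i, d i ≠ 0) :
    (Matrix.diagonal d)⁻¹ = Matrix.diagonal fun i => (d i)⁻¹ := by
  apply Matrix.inv_eq_right_inv
  rw [Matrix.diagonal_mul_diagonal, ← Matrix.diagonal_one]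
  congr 1
  ext i
  exact mul_inv_cancel₀ (hd i)

theorem cnsMetric_inv {r₀ L₀ : ℝ} {ξ h : ℝ → ℝ} {x : Fin 4 → ℝ} (hr₀ : r₀ ≠ 0) (hL₀ : L₀ ≠ 0)
    (hξ : ξ (x 1) ≠ 0) (hh : h (x 2) ≠ 0) :
    (cnsMetric r₀ L₀ ξ h x)⁻¹ = Matrix.diagonal ![-(r₀ ^ 2 / L₀ * ξ (x 1) ^ 2)⁻¹,
      (r₀ ^ 2 / L₀)⁻¹, (r₀ ^ 2)⁻¹, (r₀ ^ 2 * h (x 2) ^ 2)⁻¹] := by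
  unfold cnsMetric
  rw [inv_diagonal_of_ne_zero]
  · congr 1
    ext i
    fin_cases i <;> simp
  · intro i
    fin_cases i <;> simp [hr₀, hL₀, hξ, hh]

theorem pd_cnsMetric {r₀ L₀ : ℝ} {ξ h : ℝ → ℝ} {x : Fin 4 → ℝ}
    (hξ : DifferentiableAt ℝ ξ (x 1)) (hh : DifferentiableAt ℝ h (x 2)) (i j l : Fin 4) :
    pd i (fun y => cnsMetric r₀ L₀ ξ h y j l) x =
      if i = 1 ∧ j = 0 ∧ l = 0 then -(r₀ ^ 2 / L₀ * (2 * ξ (x 1) * deriv ξ (x 1)))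
      else if i = 2 ∧ j = 3 ∧ l = 3 then r₀ ^ 2 * (2 * h (x 2) * deriv h (x 2))
      else 0 := by
  by_cases hjl : j = l
  · subst hjl
    have hsq : ∀ {f : ℝ → ℝ} {s : ℝ}, DifferentiableAt ℝ f s → ∀ c : ℝ,
        deriv (fun s => c * f s ^ 2) s = c * (2 * f s * deriv f s) := by
      intro f s hf c
      rw [deriv_const_mul _ (hf.fun_pow 2), deriv_fun_pow hf 2]
      norm_num
    have h0 : pd i (fun y => cnsMetric r₀ L₀ ξ h y 0 0) x =
        if i = 1 then -(r₀ ^ 2 / L₀ * (2 * ξ (x 1) * deriv ξ (x 1))) else 0 := by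
      rw [← neg_mul, ← hsq hξ, ← pd_comp_apply]
      simp [cnsMetric]
    have h3 : pd i (fun y => cnsMetric r₀ L₀ ξ h y 3 3) x =
        if i = 2 then r₀ ^ 2 * (2 * h (x 2) * deriv h (x 2)) else 0 := by
      rw [← hsq hh, ← pd_comp_apply]
      simp [cnsMetric]
    have h1 : pd i (fun y => cnsMetric r₀ L₀ ξ h y 1 1) x = 0 := by
      simpa [cnsMetric] using pd_const i (r₀ ^ 2 / L₀) x
    have h2 : pd i (fun y => cnsMetric r₀ L₀ ξ h y 2 2) x = 0 := by
      simpa [cnsMetric] using pd_const i (r₀ ^ 2) x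
    fin_cases j
    · refine h0.trans ?_
      fin_cases i <;> simp
    · refine h1.trans ?_
      fin_cases i <;> simp
    · refine h2.trans ?_
      fin_cases i <;> simp
    · refine h3.trans ?_
      fin_cases i <;> simp
  · simp only [cnsMetric, Matrix.diagonal_apply_ne _ hjl, pd_const]
    rw [if_neg (fun H => hjl (H.2.1.trans H.2.2.symm)),
      if_neg (fun H => hjl (H.2.1.trans H.2.2.symm))]

theorem christoffel_cnsMetric {r₀ L₀ : ℝ} {ξ h : ℝ → ℝ} {x : Fin 4 → ℝ} (hr₀ : r₀ ≠ 0)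
    (hL₀ : L₀ ≠ 0) (hξ0 : ξ (x 1) ≠ 0) (hh0 : h (x 2) ≠ 0)
    (hξ : DifferentiableAt ℝ ξ (x 1)) (hh : DifferentiableAt ℝ h (x 2)) (k i j : Fin 4) :
    christoffel (cnsMetric r₀ L₀ ξ h) k i j x =
      cnsChristoffel (ξ (x 1)) (deriv ξ (x 1)) (h (x 2)) (deriv h (x 2)) k i j := by
  unfold christoffel
  rw [cnsMetric_inv hr₀ hL₀ hξ0 hh0]
  simp only [pd_cnsMetric hξ hh]
  rw [Finset.sum_eq_single k (fun b _ hb => by rw [Matrix.diagonal_apply_ne _ hb.symm, zero_mul])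
    (by simp), Matrix.diagonal_apply_eq]
  fin_cases k <;> fin_cases i <;> fin_cases j <;>
    simp [cnsChristoffel] <;> field_simp

theorem pd_cnsChristoffel {ξ h : ℝ → ℝ} {x : Fin 4 → ℝ} (hξ0 : ξ (x 1) ≠ 0) (hh0 : h (x 2) ≠ 0)
    (hξ : DifferentiableAt ℝ ξ (x 1)) (hh : DifferentiableAt ℝ h (x 2))
    (hξ' : DifferentiableAt ℝ (deriv ξ) (x 1)) (hh' : DifferentiableAt ℝ (deriv h) (x 2))
    (m k i j : Fin 4) :
    pd m (fun y => cnsChristoffel (ξ (y 1)) (deriv ξ (y 1)) (h (y 2)) (deriv h (y 2)) k i j) x =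
      if m = 1 ∧ (k = 0 ∧ i = 0 ∧ j = 1 ∨ k = 0 ∧ i = 1 ∧ j = 0) then
        deriv (deriv ξ) (x 1) / ξ (x 1) - (deriv ξ (x 1) / ξ (x 1)) ^ 2
      else if m = 1 ∧ k = 1 ∧ i = 0 ∧ j = 0 then
        deriv ξ (x 1) ^ 2 + ξ (x 1) * deriv (deriv ξ) (x 1)
      else if m = 2 ∧ k = 2 ∧ i = 3 ∧ j = 3 then
        -(deriv h (x 2) ^ 2 + h (x 2) * deriv (deriv h) (x 2))
      else if m = 2 ∧ (k = 3 ∧ i = 2 ∧ j = 3 ∨ k = 3 ∧ i = 3 ∧ j = 2) then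
        deriv (deriv h) (x 2) / h (x 2) - (deriv h (x 2) / h (x 2)) ^ 2
      else 0 := by
  have hdiv : ∀ {f : ℝ → ℝ} {s : ℝ}, f s ≠ 0 → DifferentiableAt ℝ f s →
      DifferentiableAt ℝ (deriv f) s → deriv (fun s => deriv f s / f s) s =
        deriv (deriv f) s / f s - (deriv f s / f s) ^ 2 := by
    intro f s h0 hf hf'
    rw [deriv_fun_div hf' hf h0]
    field_simp
  have hmul : ∀ {f : ℝ → ℝ} {s : ℝ}, DifferentiableAt ℝ f s →
      DifferentiableAt ℝ (deriv f) s → deriv (fun s => f s * deriv f s) s =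
        deriv f s ^ 2 + f s * deriv (deriv f) s := by
    intro f s hf hf'
    rw [deriv_fun_mul hf hf']
    ring
  have e0 := pd_comp_apply m 1 (fun s => deriv ξ s / ξ s) x
  have e1 := pd_comp_apply m 1 (fun s => ξ s * deriv ξ s) x
  have e2 := pd_comp_apply m 2 (fun s => -(h s * deriv h s)) x
  have e3 := pd_comp_apply m 2 (fun s => deriv h s / h s) x
  rw [hdiv hξ0 hξ hξ'] at e0
  rw [hmul hξ hξ'] at e1
  rw [deriv.fun_neg, hmul hh hh'] at e2
  rw [hdiv hh0 hh hh'] at e3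
  unfold cnsChristoffel
  clear hdiv hmul
  split_ifs <;> first | omega | simp_all [pd_const]

/-- The curvature of the CNS type metric at `x` is that of a product of two surfaces. -/
def HasCNSCurvature (r₀ L₀ : ℝ) (ξ h : ℝ → ℝ) (x : Fin 4 → ℝ) : Prop :=
  ∀ s p q r : Fin 4, riem13 (cnsMetric r₀ L₀ ξ h) s p q r x =
      -cnsEigen₁ r₀ L₀ ξ x *
          (kron s p * cnsBlock₁ r₀ L₀ ξ x q r - kron s q * cnsBlock₁ r₀ L₀ ξ x p r)
        * (if s < 2 then 1 else 0)
      - cnsEigen₂ r₀ h x * (kron s p * cnsBlock₂ r₀ h x q r - kron s q * cnsBlock₂ r₀ h x p r)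
        * (if s < 2 then 0 else 1)

set_option maxHeartbeats 1600000 in
theorem hasCNSCurvature_cnsMetric {r₀ L₀ : ℝ} {ξ h : ℝ → ℝ} {I J : Set ℝ} {x : Fin 4 → ℝ} (hr₀ : r₀ ≠ 0)
    (hL₀ : L₀ ≠ 0) (hI : IsOpen I) (hJ : IsOpen J)
    (hξ : ContDiffOn ℝ ∞ ξ I) (hh : ContDiffOn ℝ ∞ h J)
    (hξ0 : ∀ r ∈ I, ξ r ≠ 0) (hh0 : ∀ θ ∈ J, h θ ≠ 0) (hx1 : x 1 ∈ I) (hx2 : x 2 ∈ J) :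
    HasCNSCurvature r₀ L₀ ξ h x := by
  intro s p q r
  have dξ : ∀ r ∈ I, DifferentiableAt ℝ ξ r := fun r hr =>
    (hξ.differentiableOn (by simp)).differentiableAt (hI.mem_nhds hr)
  have dh : ∀ r ∈ J, DifferentiableAt ℝ h r := fun r hr =>
    (hh.differentiableOn (by simp)).differentiableAt (hJ.mem_nhds hr)
  have dξ' : DifferentiableAt ℝ (deriv ξ) (x 1) :=
    ((hξ.deriv_of_isOpen hI (m := ∞) (by simp)).differentiableOn (by simp)).differentiableAt
      (hI.mem_nhds hx1)
  have dh' : DifferentiableAt ℝ (deriv h) (x 2) :=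
    ((hh.deriv_of_isOpen hJ (m := ∞) (by simp)).differentiableOn (by simp)).differentiableAt
      (hJ.mem_nhds hx2)
  have hpd : ∀ m k i j : Fin 4, pd m (christoffel (cnsMetric r₀ L₀ ξ h) k i j) x =
      pd m (fun y => cnsChristoffel (ξ (y 1)) (deriv ξ (y 1)) (h (y 2)) (deriv h (y 2)) k i j) x := by
    intro m k i j
    -- Differentiating the closed form needs it on a neighbourhood of `x`; openness of `I` and `J`
    -- provides one.
    apply pd_congr
    filter_upwards [(continuous_apply 1).continuousAt.preimage_mem_nhds (hI.mem_nhds hx1),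
      (continuous_apply 2).continuousAt.preimage_mem_nhds (hJ.mem_nhds hx2)] with y hy1 hy2
    exact christoffel_cnsMetric hr₀ hL₀ (hξ0 _ hy1) (hh0 _ hy2) (dξ _ hy1) (dh _ hy2) k i j
  have hu := hξ0 _ hx1
  have hv := hh0 _ hx2
  unfold riem13
  simp only [hpd, pd_cnsChristoffel hu hv (dξ _ hx1) (dh _ hx2) dξ' dh',
    christoffel_cnsMetric hr₀ hL₀ hu hv (dξ _ hx1) (dh _ hx2), cnsBlock₁, cnsBlock₂,
    cnsEigen₁, cnsEigen₂, Fin.sum_univ_four]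
  -- With the jets of `ξ` and `h` as free variables, each component is a rational identity.
  generalize deriv (deriv ξ) (x 1) = u2
  generalize deriv (deriv h) (x 2) = v2
  generalize deriv ξ (x 1) = u1
  generalize deriv h (x 2) = v1
  generalize ξ (x 1) = u at *
  generalize h (x 2) = v at *
  clear hpd dξ dh dξ' dh' hξ hh hξ0 hh0
  fin_cases s <;> fin_cases p <;> fin_cases q <;> fin_cases r <;>
    simp [cnsChristoffel, kron] <;> field_simp <;> ring

/-! ### Algebra of curvature-like tensors on a product -/

/-- Q(E, ·) is the derivation action of the endomorphisms Z ↦ E(Y,Z)X - E(X,Z)Y. These are skew for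
E, so they annihilate E and everything built from it; E may be degenerate. -/
theorem tachibana_kulkarniNomizu_self {n : ℕ} {E : Fin n → Fin n → ℝ} (hE : ∀ i j, E i j = E j i)
    (p₁ p₂ p₃ p₄ r s : Fin n) :
    tachibana E (kulkarniNomizu E E) p₁ p₂ p₃ p₄ r s = 0 := by
  unfold tachibana kulkarniNomizu
  rw [hE s p₁, hE s p₂, hE s p₃, hE s p₄, hE r p₁, hE r p₂, hE r p₃, hE r p₄]
  ring

/-- If `r` and `s` lie in the first factor of a product metric `E + F`, then the components
`rs` of `Q(E + F, T)` vanish for `T` a combination of `E ∧ E` and `F ∧ F`. -/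
theorem tachibana_product_eq_zero {n : ℕ} {E F g : Fin n → Fin n → ℝ}
    {T : Fin n → Fin n → Fin n → Fin n → ℝ} {a b : ℝ}
    (hE : ∀ i j, E i j = E j i) (hF : ∀ i j, F i j = F j i) (hg : ∀ i j, g i j = E i j + F i j)
    (hT : ∀ p q r s, T p q r s = a * kulkarniNomizu E E p q r s + b * kulkarniNomizu F F p q r s)
    {r s : Fin n} (hr : ∀ i, F r i = 0) (hs : ∀ i, F s i = 0) (p₁ p₂ p₃ p₄ : Fin n) :
    tachibana g T p₁ p₂ p₃ p₄ r s = 0 := by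
  have hr' : ∀ i, F i r = 0 := fun i => (hF i r).trans (hr i)
  have hs' : ∀ i, F i s = 0 := fun i => (hF i s).trans (hs i)
  have h := tachibana_kulkarniNomizu_self hE p₁ p₂ p₃ p₄ r s
  unfold tachibana kulkarniNomizu at h
  -- Every term containing `F` has a factor `F` with an index `r` or `s`; what survives is `a` times
  -- Q(E, E∧E).
  simp only [tachibana, hT, hg, kulkarniNomizu, hr, hs, hr', hs']
  linear_combination a * h

/-- If `U_{pqrs}` is a multiple of `g_{ps} g_{qr} - g_{pr} g_{qs}`, with a factor that depends on
`p` and `q`, then `U · T` is the corresponding multiple of `Q(g, T)`. -/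
theorem dotAct_of_sectional {n : ℕ} {g ginv : Matrix (Fin n) (Fin n) ℝ}
    {U : Fin n → Fin n → Fin n → Fin n → ℝ} {u : Fin n → Fin n → ℝ}
    (hg : ginv * g.transpose = 1)
    (hU : ∀ p q r s, U p q r s = u p q * (g p s * g q r - g p r * g q s))
    (T : Fin n → Fin n → Fin n → Fin n → ℝ) (p₁ p₂ p₃ p₄ r s : Fin n) :
    dotAct ginv U T p₁ p₂ p₃ p₄ r s = -u r s * tachibana g T p₁ p₂ p₃ p₄ r s := by
  have hinv : ∀ a i, ∑ b, ginv a b * g i b = if a = i then 1 else 0 := by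
    intro a i
    have := congrFun (congrFun hg a) i
    simpa [Matrix.mul_apply, Matrix.one_apply] using this
  have key : ∀ (p : Fin n) (f : Fin n → ℝ), ∑ a, ∑ b, ginv a b * (U r s p b * f a) =
      u r s * (g s p * f r - g r p * f s) := by
    intro p f
    have h1 : ∀ a, ∑ b, ginv a b * (U r s p b * f a) =
        u r s * (g s p * ((if a = r then 1 else 0) * f a) -
          g r p * ((if a = s then 1 else 0) * f a)) := by
      intro a
      rw [← hinv a r, ← hinv a s]
      simp only [Finset.sum_mul, Finset.mul_sum, ← Finset.sum_sub_distrib, hU]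
      refine Finset.sum_congr rfl fun b _ => ?_
      ring
    simp only [h1]
    rw [← Finset.mul_sum, Finset.sum_sub_distrib, ← Finset.mul_sum, ← Finset.mul_sum]
    simp
  unfold dotAct
  simp only [mul_add, Finset.sum_add_distrib]
  rw [key p₁ fun a => T a p₂ p₃ p₄, key p₂ fun a => T p₁ a p₃ p₄, key p₃ fun a => T p₁ p₂ a p₄,
    key p₄ fun a => T p₁ p₂ p₃ a]
  unfold tachibana
  ring

/-- In a product of two surfaces, a combination of `E ∧ E`, `F ∧ F` and `E ∧ F` is a multiple of
`g_{ps} g_{qr} - g_{pr} g_{qs}`, with a factor that depends on the factors of `p` and `q`. -/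
theorem kulkarniNomizu_product_sectional {n : ℕ} {E F g : Fin n → Fin n → ℝ} {P : Fin n → Prop}
    [DecidablePred P] (hg : ∀ i j, g i j = E i j + F i j)
    (hE : ∀ i, ¬P i → ∀ j, E i j = 0) (hF : ∀ i, P i → ∀ j, F i j = 0) (a b c : ℝ)
    (p q r s : Fin n) :
    a * kulkarniNomizu E E p q r s + b * kulkarniNomizu F F p q r s
        + c * kulkarniNomizu E F p q r s =
      (if P p then if P q then 2 * a else c else if P q then c else 2 * b) *
        (g p s * g q r - g p r * g q s) := by
  unfold kulkarniNomizu
  by_cases hp : P p <;> by_cases hq : P q <;> simp only [hp, hq, if_true, if_false, hg] <;>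
    first
    | (simp only [hF p hp, hF q hq]; ring)
    | (simp only [hF p hp, hE q hq]; ring)
    | (simp only [hE p hp, hF q hq]; ring)
    | (simp only [hE p hp, hE q hq]; ring)

theorem cnsMetric_eq_add (r₀ L₀ : ℝ) (ξ h : ℝ → ℝ) (x : Fin 4 → ℝ) (i j : Fin 4) :
    cnsMetric r₀ L₀ ξ h x i j = cnsBlock₁ r₀ L₀ ξ x i j + cnsBlock₂ r₀ h x i j := by
  fin_cases i <;> fin_cases j <;> simp [cnsMetric, cnsBlock₁, cnsBlock₂]

theorem diagonal_symm {n : ℕ} (d : Fin n → ℝ) (i j : Fin n) :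
    Matrix.diagonal d i j = Matrix.diagonal d j i := by
  conv_lhs => rw [← Matrix.diagonal_transpose]
  rfl

theorem cnsBlock₁_symm (r₀ L₀ : ℝ) (ξ : ℝ → ℝ) (x : Fin 4 → ℝ) (i j : Fin 4) :
    cnsBlock₁ r₀ L₀ ξ x i j = cnsBlock₁ r₀ L₀ ξ x j i :=
  diagonal_symm _ i j

theorem cnsBlock₂_symm (r₀ : ℝ) (h : ℝ → ℝ) (x : Fin 4 → ℝ) (i j : Fin 4) :
    cnsBlock₂ r₀ h x i j = cnsBlock₂ r₀ h x j i :=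
  diagonal_symm _ i j

theorem cnsBlock₁_eq_zero (r₀ L₀ : ℝ) (ξ : ℝ → ℝ) (x : Fin 4 → ℝ) (i : Fin 4) (hi : ¬i < 2)
    (j : Fin 4) : cnsBlock₁ r₀ L₀ ξ x i j = 0 := by
  fin_cases i <;> fin_cases j <;> simp_all [cnsBlock₁]

theorem cnsBlock₂_eq_zero (r₀ : ℝ) (h : ℝ → ℝ) (x : Fin 4 → ℝ) (i : Fin 4) (hi : i < 2)
    (j : Fin 4) : cnsBlock₂ r₀ h x i j = 0 := by
  fin_cases i <;> fin_cases j <;> simp_all [cnsBlock₂]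

/-- Lowering the index of the projector onto a factor yields the metric of that factor. -/
theorem cnsMetric_mul_kron₁ (r₀ L₀ : ℝ) (ξ h : ℝ → ℝ) (x : Fin 4 → ℝ) (s p : Fin 4) :
    cnsMetric r₀ L₀ ξ h x s s * (kron s p * if s < 2 then 1 else 0) =
      cnsBlock₁ r₀ L₀ ξ x p s := by
  fin_cases s <;> fin_cases p <;> simp [cnsMetric, cnsBlock₁, kron]

theorem cnsMetric_mul_kron₂ (r₀ L₀ : ℝ) (ξ h : ℝ → ℝ) (x : Fin 4 → ℝ) (s p : Fin 4) :
    cnsMetric r₀ L₀ ξ h x s s * (kron s p * if s < 2 then 0 else 1) =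
      cnsBlock₂ r₀ h x p s := by
  fin_cases s <;> fin_cases p <;> simp [cnsMetric, cnsBlock₂, kron]

theorem sum_cnsMetric_mul (r₀ L₀ : ℝ) (ξ h : ℝ → ℝ) (x : Fin 4 → ℝ) (s : Fin 4) (f : Fin 4 → ℝ) :
    ∑ t, cnsMetric r₀ L₀ ξ h x s t * f t = cnsMetric r₀ L₀ ξ h x s s * f s :=
  Finset.sum_eq_single s
    (fun b _ hb => by rw [cnsMetric, Matrix.diagonal_apply_ne _ hb.symm, zero_mul]) (by simp)

theorem cnsMetric_inv_mul_transpose {r₀ L₀ : ℝ} {ξ h : ℝ → ℝ} {x : Fin 4 → ℝ} (hr₀ : r₀ ≠ 0)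
    (hL₀ : L₀ ≠ 0) (hξ : ξ (x 1) ≠ 0) (hh : h (x 2) ≠ 0) :
    (cnsMetric r₀ L₀ ξ h x)⁻¹ * (cnsMetric r₀ L₀ ξ h x).transpose = 1 := by
  have ht : (cnsMetric r₀ L₀ ξ h x).transpose = cnsMetric r₀ L₀ ξ h x := by
    simp [cnsMetric]
  rw [ht]
  apply Matrix.nonsing_inv_mul
  simp [cnsMetric, Matrix.det_diagonal, Fin.prod_univ_four, hr₀, hL₀, hξ, hh]

/-! ### Ricci, Weyl and the action on the curvature tensor -/

section Curvature

variable {r₀ L₀ : ℝ} {ξ h : ℝ → ℝ} {x : Fin 4 → ℝ}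

theorem HasCNSCurvature.riem_eq (hR : HasCNSCurvature r₀ L₀ ξ h x) (p q r s : Fin 4) :
    riem (cnsMetric r₀ L₀ ξ h) x p q r s =
      -cnsEigen₁ r₀ L₀ ξ x / 2 *
          kulkarniNomizu (cnsBlock₁ r₀ L₀ ξ x) (cnsBlock₁ r₀ L₀ ξ x) p q r s
        + -cnsEigen₂ r₀ h x / 2 *
          kulkarniNomizu (cnsBlock₂ r₀ h x) (cnsBlock₂ r₀ h x) p q r s := by
  unfold riem kulkarniNomizu
  rw [sum_cnsMetric_mul, hR, ← cnsMetric_mul_kron₁ r₀ L₀ ξ h x s p,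
    ← cnsMetric_mul_kron₁ r₀ L₀ ξ h x s q, ← cnsMetric_mul_kron₂ r₀ L₀ ξ h x s p,
    ← cnsMetric_mul_kron₂ r₀ L₀ ξ h x s q]
  ring

/-- On each block the contraction gives -(1 - 2) = 1 times the eigenvalue, since the block has
dimension two. -/
theorem HasCNSCurvature.ricci_eq (hR : HasCNSCurvature r₀ L₀ ξ h x) (p q : Fin 4) :
    ricci (cnsMetric r₀ L₀ ξ h) x p q =
      cnsEigen₁ r₀ L₀ ξ x * cnsBlock₁ r₀ L₀ ξ x p q + cnsEigen₂ r₀ h x * cnsBlock₂ r₀ h x p q := by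
  unfold ricci
  simp only [hR _ _ _ _, Fin.sum_univ_four]
  fin_cases p <;> fin_cases q <;> simp [kron, cnsBlock₁, cnsBlock₂]

theorem HasCNSCurvature.ricciOp_eq (hR : HasCNSCurvature r₀ L₀ ξ h x) (hr₀ : r₀ ≠ 0)
    (hL₀ : L₀ ≠ 0) (hξ : ξ (x 1) ≠ 0) (hh : h (x 2) ≠ 0) (s q : Fin 4) :
    ricciOp (cnsMetric r₀ L₀ ξ h) x s q =
      kron s q * if s < 2 then cnsEigen₁ r₀ L₀ ξ x else cnsEigen₂ r₀ h x := by
  unfold ricciOp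
  rw [cnsMetric_inv hr₀ hL₀ hξ hh]
  simp only [hR.ricci_eq, Fin.sum_univ_four]
  generalize cnsEigen₁ r₀ L₀ ξ x = a
  generalize cnsEigen₂ r₀ h x = b
  fin_cases s <;> fin_cases q <;> simp [kron, cnsBlock₁, cnsBlock₂] <;> field_simp

theorem HasCNSCurvature.scal_eq (hR : HasCNSCurvature r₀ L₀ ξ h x) (hr₀ : r₀ ≠ 0)
    (hL₀ : L₀ ≠ 0) (hξ : ξ (x 1) ≠ 0) (hh : h (x 2) ≠ 0) :
    scal (cnsMetric r₀ L₀ ξ h) x = 2 * (cnsEigen₁ r₀ L₀ ξ x + cnsEigen₂ r₀ h x) := by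
  unfold scal
  simp only [hR.ricciOp_eq hr₀ hL₀ hξ hh, Fin.sum_univ_four]
  simp [kron]
  ring

theorem HasCNSCurvature.ricciSq_eq (hR : HasCNSCurvature r₀ L₀ ξ h x) (hr₀ : r₀ ≠ 0)
    (hL₀ : L₀ ≠ 0) (hξ : ξ (x 1) ≠ 0) (hh : h (x 2) ≠ 0) (p q : Fin 4) :
    ricciSq (cnsMetric r₀ L₀ ξ h) x p q =
      cnsEigen₁ r₀ L₀ ξ x ^ 2 * cnsBlock₁ r₀ L₀ ξ x p q
        + cnsEigen₂ r₀ h x ^ 2 * cnsBlock₂ r₀ h x p q := by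
  unfold ricciSq
  simp only [hR.ricciOp_eq hr₀ hL₀ hξ hh, hR.ricci_eq, Fin.sum_univ_four]
  fin_cases p <;> fin_cases q <;> simp [kron, cnsBlock₁, cnsBlock₂] <;> ring

/-- In C = R + (1/2) g∧S - (κ/12) g∧g, the E∧E and F∧F parts of R cancel those of (1/2) g∧S. This
leaves ((a+b)/2) E∧F - ((a+b)/6) g∧g, as κ = 2(a+b). -/
theorem HasCNSCurvature.weyl_eq (hR : HasCNSCurvature r₀ L₀ ξ h x) (hr₀ : r₀ ≠ 0)
    (hL₀ : L₀ ≠ 0) (hξ : ξ (x 1) ≠ 0) (hh : h (x 2) ≠ 0) (p q r s : Fin 4) :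
    weyl (cnsMetric r₀ L₀ ξ h) x p q r s =
      -(cnsEigen₁ r₀ L₀ ξ x + cnsEigen₂ r₀ h x) / 6 *
          kulkarniNomizu (cnsBlock₁ r₀ L₀ ξ x) (cnsBlock₁ r₀ L₀ ξ x) p q r s
        + -(cnsEigen₁ r₀ L₀ ξ x + cnsEigen₂ r₀ h x) / 6 *
          kulkarniNomizu (cnsBlock₂ r₀ h x) (cnsBlock₂ r₀ h x) p q r s
        + (cnsEigen₁ r₀ L₀ ξ x + cnsEigen₂ r₀ h x) / 6 *
          kulkarniNomizu (cnsBlock₁ r₀ L₀ ξ x) (cnsBlock₂ r₀ h x) p q r s := by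
  have hriem := hR.riem_eq p q r s
  rw [riem, sum_cnsMetric_mul] at hriem
  have hif : ∀ a b : ℝ, (if s < 2 then a else b) =
      a * (if s < 2 then 1 else 0) + b * (if s < 2 then 0 else 1) := by
    intro a b
    split_ifs <;> simp
  have h1 : (if s < 2 then (1 : ℝ) else 0) + (if s < 2 then 0 else 1) = 1 := by
    split_ifs <;> simp
  have hk : ∀ i, cnsMetric r₀ L₀ ξ h x s s * kron s i =
      cnsBlock₁ r₀ L₀ ξ x i s + cnsBlock₂ r₀ h x i s := by
    intro i
    rw [← cnsMetric_mul_kron₁ r₀ L₀ ξ h x s i, ← cnsMetric_mul_kron₂ r₀ L₀ ξ h x s i]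
    linear_combination -cnsMetric r₀ L₀ ξ h x s s * kron s i * h1
  have hS : ∀ i, cnsMetric r₀ L₀ ξ h x s s * ricciOp (cnsMetric r₀ L₀ ξ h) x s i =
      cnsEigen₁ r₀ L₀ ξ x * cnsBlock₁ r₀ L₀ ξ x i s
        + cnsEigen₂ r₀ h x * cnsBlock₂ r₀ h x i s := by
    intro i
    rw [hR.ricciOp_eq hr₀ hL₀ hξ hh, ← cnsMetric_mul_kron₁ r₀ L₀ ξ h x s i,
      ← cnsMetric_mul_kron₂ r₀ L₀ ξ h x s i, hif]
    ring
  rw [weyl, sum_cnsMetric_mul, weyl13, mul_sub, mul_add, hriem, hR.scal_eq hr₀ hL₀ hξ hh]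
  simp only [hR.ricci_eq]
  set g := cnsMetric r₀ L₀ ξ h x with hgdef
  have hg : ∀ i j, g i j = cnsBlock₁ r₀ L₀ ξ x i j + cnsBlock₂ r₀ h x i j :=
    cnsMetric_eq_add r₀ L₀ ξ h x
  generalize cnsEigen₁ r₀ L₀ ξ x = a at *
  generalize cnsEigen₂ r₀ h x = b at *
  have hkp := hk p
  have hkq := hk q
  have hSp := hS p
  have hSq := hS q
  rw [hg q r, hg p r]
  unfold kulkarniNomizu
  generalize cnsBlock₁ r₀ L₀ ξ x = E at *
  generalize cnsBlock₂ r₀ h x = F at *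
  push_cast
  linear_combination (1 / 2) * (a * E q r + b * F q r) * hkp - (1 / 2) * (a * E p r + b * F p r) * hkq
    + (1 / 2) * (E q r + F q r) * hSp - (1 / 2) * (E p r + F p r) * hSq
    - (a + b) / 3 * ((E q r + F q r) * hkp - (E p r + F p r) * hkq)

theorem HasCNSCurvature.tachibana_riem_eq_zero (hR : HasCNSCurvature r₀ L₀ ξ h x) {r s : Fin 4}
    (hrs : r < 2 ↔ s < 2) (p₁ p₂ p₃ p₄ : Fin 4) :
    tachibana (cnsMetric r₀ L₀ ξ h x) (riem (cnsMetric r₀ L₀ ξ h) x) p₁ p₂ p₃ p₄ r s = 0 := by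
  have hE := cnsBlock₁_symm r₀ L₀ ξ x
  have hF := cnsBlock₂_symm r₀ h x
  have hg := cnsMetric_eq_add r₀ L₀ ξ h x
  by_cases hr : r < 2
  · exact tachibana_product_eq_zero hE hF hg hR.riem_eq
      (cnsBlock₂_eq_zero r₀ h x r hr) (cnsBlock₂_eq_zero r₀ h x s (hrs.1 hr)) p₁ p₂ p₃ p₄
  · exact tachibana_product_eq_zero hF hE (fun i j => (hg i j).trans (add_comm _ _))
      (fun p q r s => (hR.riem_eq p q r s).trans (add_comm _ _))
      (cnsBlock₁_eq_zero r₀ L₀ ξ x r hr) (cnsBlock₁_eq_zero r₀ L₀ ξ x s (fun H => hr (hrs.2 H)))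
      p₁ p₂ p₃ p₄

/-- The product of the two surfaces acts on the curvature tensor through the mixed planes only. -/
theorem HasCNSCurvature.dotAct_riem (hR : HasCNSCurvature r₀ L₀ ξ h x) (hr₀ : r₀ ≠ 0)
    (hL₀ : L₀ ≠ 0) (hξ : ξ (x 1) ≠ 0) (hh : h (x 2) ≠ 0)
    {U : Fin 4 → Fin 4 → Fin 4 → Fin 4 → ℝ} {a b c : ℝ}
    (hU : ∀ p q r s, U p q r s =
      a * kulkarniNomizu (cnsBlock₁ r₀ L₀ ξ x) (cnsBlock₁ r₀ L₀ ξ x) p q r s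
        + b * kulkarniNomizu (cnsBlock₂ r₀ h x) (cnsBlock₂ r₀ h x) p q r s
        + c * kulkarniNomizu (cnsBlock₁ r₀ L₀ ξ x) (cnsBlock₂ r₀ h x) p q r s)
    (p₁ p₂ p₃ p₄ r s : Fin 4) :
    dotAct (cnsMetric r₀ L₀ ξ h x)⁻¹ U (riem (cnsMetric r₀ L₀ ξ h) x) p₁ p₂ p₃ p₄ r s =
      -c * tachibana (cnsMetric r₀ L₀ ξ h x) (riem (cnsMetric r₀ L₀ ξ h) x) p₁ p₂ p₃ p₄ r s := by
  rw [dotAct_of_sectional (cnsMetric_inv_mul_transpose hr₀ hL₀ hξ hh)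
    (fun p q r s => (hU p q r s).trans (kulkarniNomizu_product_sectional
      (cnsMetric_eq_add r₀ L₀ ξ h x) (P := fun i => i < 2) (cnsBlock₁_eq_zero r₀ L₀ ξ x)
      (cnsBlock₂_eq_zero r₀ h x) a b c p q r s))]
  -- Within one factor both sides vanish; on a mixed plane the sectional factor is exactly `c`.
  by_cases hrs : r < 2 ↔ s < 2
  · rw [hR.tachibana_riem_eq_zero hrs, mul_zero, mul_zero]
  · by_cases hr : r < 2 <;> by_cases hs : s < 2 <;> simp_all

end Curvature

/-! ### Roter type -/

theorem isRoterTypeOn_cnsMetric {r₀ L₀ : ℝ} {ξ h : ℝ → ℝ} {I J : Set ℝ} (hr₀ : r₀ ≠ 0)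
    (hL₀ : L₀ ≠ 0) (hI : IsOpen I) (hJ : IsOpen J)
    (hξ : ContDiffOn ℝ ∞ ξ I) (hh : ContDiffOn ℝ ∞ h J)
    (hξ0 : ∀ r ∈ I, ξ r ≠ 0) (hh0 : ∀ θ ∈ J, h θ ≠ 0) :
    IsRoterTypeOn (cnsMetric r₀ L₀ ξ h)
      {x : Fin 4 → ℝ | x 1 ∈ I ∧ x 2 ∈ J ∧
        L₀ * h (x 2) * deriv (deriv ξ) (x 1) - ξ (x 1) * deriv (deriv h) (x 2) ≠ 0} := by
  set W := {x : Fin 4 → ℝ | x 1 ∈ I ∧ x 2 ∈ J ∧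
    L₀ * h (x 2) * deriv (deriv ξ) (x 1) - ξ (x 1) * deriv (deriv h) (x 2) ≠ 0}
  have hWI : Set.MapsTo (fun x : Fin 4 → ℝ => x 1) W I := fun x hx => hx.1
  have hWJ : Set.MapsTo (fun x : Fin 4 → ℝ => x 2) W J := fun x hx => hx.2.1
  have c1 : ContDiffOn ℝ ∞ (fun x : Fin 4 → ℝ => x 1) W := (contDiff_apply ℝ ℝ 1).contDiffOn
  have c2 : ContDiffOn ℝ ∞ (fun x : Fin 4 → ℝ => x 2) W := (contDiff_apply ℝ ℝ 2).contDiffOn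
  have hξ2 : ContDiffOn ℝ ∞ (deriv (deriv ξ)) I :=
    (hξ.deriv_of_isOpen hI (m := ∞) (by simp)).deriv_of_isOpen hI (by simp)
  have hh2 : ContDiffOn ℝ ∞ (deriv (deriv h)) J :=
    (hh.deriv_of_isOpen hJ (m := ∞) (by simp)).deriv_of_isOpen hJ (by simp)
  have ha : ContDiffOn ℝ ∞ (cnsEigen₁ r₀ L₀ ξ) W :=
    (contDiffOn_const.mul (hξ2.comp c1 hWI)).div (contDiffOn_const.mul (hξ.comp c1 hWI))
      fun x hx => mul_ne_zero (pow_ne_zero 2 hr₀) (hξ0 _ hx.1)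
  have hb : ContDiffOn ℝ ∞ (cnsEigen₂ r₀ h) W :=
    (hh2.comp c2 hWJ).div (contDiffOn_const.mul (hh.comp c2 hWJ))
      fun x hx => mul_ne_zero (pow_ne_zero 2 hr₀) (hh0 _ hx.2.1)
  have hne : ∀ x ∈ W, cnsEigen₁ r₀ L₀ ξ x - cnsEigen₂ r₀ h x ≠ 0 := by
    intro x hx
    have h1 := hξ0 _ hx.1
    have h2 := hh0 _ hx.2.1
    have : cnsEigen₁ r₀ L₀ ξ x - cnsEigen₂ r₀ h x =
        (L₀ * h (x 2) * deriv (deriv ξ) (x 1) - ξ (x 1) * deriv (deriv h) (x 2)) /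
          (r₀ ^ 2 * ξ (x 1) * h (x 2)) := by
      unfold cnsEigen₁ cnsEigen₂
      field_simp
    rw [this]
    exact div_ne_zero hx.2.2 (mul_ne_zero (mul_ne_zero (pow_ne_zero 2 hr₀) h1) h2)
  have hD : ∀ x ∈ W, 2 * (cnsEigen₁ r₀ L₀ ξ x - cnsEigen₂ r₀ h x) ^ 2 ≠ 0 :=
    fun x hx => mul_ne_zero two_ne_zero (pow_ne_zero 2 (hne x hx))
  have hDs : ContDiffOn ℝ ∞ (fun x => 2 * (cnsEigen₁ r₀ L₀ ξ x - cnsEigen₂ r₀ h x) ^ 2) W :=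
    contDiffOn_const.mul ((ha.sub hb).pow 2)
  -- Coefficients obtained by putting E = (S - bg)/(a - b) and F = (ag - S)/(a - b) into -(a/2) E∧E
  -- - (b/2) F∧F.
  refine ⟨fun x => -(cnsEigen₁ r₀ L₀ ξ x * cnsEigen₂ r₀ h x *
        (cnsEigen₁ r₀ L₀ ξ x + cnsEigen₂ r₀ h x)) /
        (2 * (cnsEigen₁ r₀ L₀ ξ x - cnsEigen₂ r₀ h x) ^ 2),
    fun x => (4 * (cnsEigen₁ r₀ L₀ ξ x * cnsEigen₂ r₀ h x)) /
        (2 * (cnsEigen₁ r₀ L₀ ξ x - cnsEigen₂ r₀ h x) ^ 2),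
    fun x => -(cnsEigen₁ r₀ L₀ ξ x + cnsEigen₂ r₀ h x) /
        (2 * (cnsEigen₁ r₀ L₀ ξ x - cnsEigen₂ r₀ h x) ^ 2),
    ((ha.mul hb).mul (ha.add hb)).neg.div hDs hD,
    (contDiffOn_const.mul (ha.mul hb)).div hDs hD, (ha.add hb).neg.div hDs hD, ?_⟩
  intro x hx p q r s
  have hR : HasCNSCurvature r₀ L₀ ξ h x :=
    hasCNSCurvature_cnsMetric hr₀ hL₀ hI hJ hξ hh hξ0 hh0 hx.1 hx.2.1
  have hd := hne x hx
  rw [hR.riem_eq]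
  simp only [kulkarniNomizu, hR.ricci_eq, cnsMetric_eq_add]
  generalize cnsEigen₁ r₀ L₀ ξ x = a at *
  generalize cnsEigen₂ r₀ h x = b at *
  field_simp
  ring

end

end CNSType

theorem mainTheorem6 (r₀ L₀ : ℝ) (hr₀ : 0 < r₀) (hL₀ : 0 < L₀) (hL₀' : L₀ ≤ 1)
    (I J : Set ℝ) (hI : IsOpen I) (hJ : IsOpen J) (ξ h : ℝ → ℝ)
    (hξ : ContDiffOn ℝ ∞ ξ I) (hh : ContDiffOn ℝ ∞ h J)
    (hξ0 : ∀ r ∈ I, ξ r ≠ 0) (hh0 : ∀ θ ∈ J, h θ ≠ 0) :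
    -- Roter type
    CNSType.IsRoterTypeOn (CNSType.cnsMetric r₀ L₀ ξ h)
      {x : Fin 4 → ℝ | x 1 ∈ I ∧ x 2 ∈ J ∧
        L₀ * h (x 2) * deriv (deriv ξ) (x 1) - ξ (x 1) * deriv (deriv h) (x 2) ≠ 0} ∧
    ∀ x : Fin 4 → ℝ, x 1 ∈ I → x 2 ∈ J →
      -- `R · R = 0`
      (∀ p₁ p₂ p₃ p₄ r s : Fin 4,
        CNSType.dotAct (CNSType.cnsMetric r₀ L₀ ξ h x)⁻¹
          (CNSType.riem (CNSType.cnsMetric r₀ L₀ ξ h) x)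
          (CNSType.riem (CNSType.cnsMetric r₀ L₀ ξ h) x) p₁ p₂ p₃ p₄ r s = 0) ∧
      -- `C · R = J' Q(g, R)`
      (∀ p₁ p₂ p₃ p₄ r s : Fin 4,
        CNSType.dotAct (CNSType.cnsMetric r₀ L₀ ξ h x)⁻¹
          (CNSType.weyl (CNSType.cnsMetric r₀ L₀ ξ h) x)
          (CNSType.riem (CNSType.cnsMetric r₀ L₀ ξ h) x) p₁ p₂ p₃ p₄ r s =
        -((L₀ * h (x 2) * deriv (deriv ξ) (x 1) + ξ (x 1) * deriv (deriv h) (x 2)) /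
            (6 * r₀ ^ 2 * ξ (x 1) * h (x 2))) *
          CNSType.tachibana (CNSType.cnsMetric r₀ L₀ ξ h x)
            (CNSType.riem (CNSType.cnsMetric r₀ L₀ ξ h) x) p₁ p₂ p₃ p₄ r s) ∧
      -- the quadratic identity for the Ricci tensor
      (∀ p q : Fin 4,
        CNSType.ricciSq (CNSType.cnsMetric r₀ L₀ ξ h) x p q
          - (L₀ * h (x 2) * deriv (deriv ξ) (x 1) + ξ (x 1) * deriv (deriv h) (x 2)) /
              (r₀ ^ 2 * ξ (x 1) * h (x 2)) * CNSType.ricci (CNSType.cnsMetric r₀ L₀ ξ h) x p q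
          + L₀ * deriv (deriv ξ) (x 1) * deriv (deriv h) (x 2) /
              (r₀ ^ 4 * ξ (x 1) * h (x 2)) * CNSType.cnsMetric r₀ L₀ ξ h x p q = 0) := by

  refine ⟨CNSType.isRoterTypeOn_cnsMetric hr₀.ne' hL₀.ne' hI hJ hξ hh hξ0 hh0, ?_⟩
  intro x hx1 hx2
  have hR : CNSType.HasCNSCurvature r₀ L₀ ξ h x :=
    CNSType.hasCNSCurvature_cnsMetric hr₀.ne' hL₀.ne' hI hJ hξ hh hξ0 hh0 hx1 hx2
  have hu := hξ0 _ hx1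
  have hv := hh0 _ hx2
  refine ⟨?_, ?_, ?_⟩
  · intro p₁ p₂ p₃ p₄ r s
    -- The curvature tensor has no E∧F part: append one with coefficient `c = 0`.
    have hU := fun p q r s => (hR.riem_eq p q r s).trans
      ((add_zero _).symm.trans (congrArg _ (zero_mul (CNSType.kulkarniNomizu
        (CNSType.cnsBlock₁ r₀ L₀ ξ x) (CNSType.cnsBlock₂ r₀ h x) p q r s)).symm))
    rw [hR.dotAct_riem hr₀.ne' hL₀.ne' hu hv hU, neg_zero, zero_mul]
  · intro p₁ p₂ p₃ p₄ r s
    rw [hR.dotAct_riem hr₀.ne' hL₀.ne' hu hv (hR.weyl_eq hr₀.ne' hL₀.ne' hu hv)]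
    congr 1
    unfold CNSType.cnsEigen₁ CNSType.cnsEigen₂
    field_simp
  · intro p q
    -- The coefficients are a + b and ab, so this is (S - a)(S - b) = 0 on each block.
    rw [hR.ricciSq_eq hr₀.ne' hL₀.ne' hu hv, hR.ricci_eq, CNSType.cnsMetric_eq_add]
    unfold CNSType.cnsEigen₁ CNSType.cnsEigen₂
    field_simp
    ring
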